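/- Let $(\ell_n)_{n\ge1}$ be a non-increasing sequence of numbers in $(0,1)$ and let \[ \delta=\liminf_{n\to\infty}\frac{n\,\ell_n}{\ln n}\in[0,\infty]. \] For a sequence $\omega=(\omega_n)_{n\ge1}$ of points of the circle $\mathbb T=\mathbb R/\mathbb Z$ put \[ E_n(\omega)=\bigcup_{k=1}^{n}\Bigl(\omega_k-\tfrac{\ell_n}{2},\,\omega_k+\tfrac{\ell_n}{2}\Bigr)\subset\mathbb T, \qquad \mathcal U(\omega)=\liminf_{n\to\infty}E_n(\omega)=\bigcup_{N\ge1}\bigcap_{n\ge N}E_n(\omega). \] Suppose that $\delta<1$. Then there is no probability density $f\in L^1(\mathbb T)$ (that is, $f\ge0$ a.e. and $\int_{\mathbb T}f\,dx=1$) such that, for centres $\omega_1,\omega_2,\dots$ that are independent and identically distributed with density $f$ with respect to Lebesgue measure on $\mathbb T$, \[ \Pr\bigl(\mathbb T\subset\mathcal U(\omega)\bigr)=1 . \] -/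

import Mathlib

open MeasureTheory ProbabilityTheory Filter
open scoped ENNReal

/-- `δ = liminf_{n → ∞} n ℓ_n / ln n`, with values in the extended reals, since the sequence need
not be bounded. The (meaningless) term at `n = 1` does not affect the value. -/
noncomputable def coveringExponent (ℓ : ℕ+ → ℝ) : EReal :=
  liminf (fun n : ℕ+ => (((n : ℕ) * ℓ n / Real.log (n : ℕ) : ℝ) : EReal)) atTop

/-- `E_n = ⋃_{k = 1}^{n} B(c_k, ℓ_n / 2)`, the union of the `n` open arcs of the same length `ℓ_n`
centred at the first `n` points of the sequence `c`. -/
def coveredSet (ℓ : ℕ+ → ℝ) (c : ℕ+ → UnitAddCircle) (n : ℕ+) : Set UnitAddCircle :=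
  ⋃ k ≤ n, Metric.ball (c k) (ℓ n / 2)

/-- `𝒰 = liminf_n E_n`. -/
def uniformCoveringSet (ℓ : ℕ+ → ℝ) (c : ℕ+ → UnitAddCircle) : Set UnitAddCircle :=
  liminf (coveredSet ℓ c) atTop

theorem mem_uniformCoveringSet (ℓ : ℕ+ → ℝ) (c : ℕ+ → UnitAddCircle) (y : UnitAddCircle) :
    y ∈ uniformCoveringSet ℓ c ↔ ∃ N : ℕ+, ∀ n ≥ N, ∃ k ≤ n, dist y (c k) < ℓ n / 2 := by
  simp [uniformCoveringSet, mem_liminf_iff_eventually_mem, coveredSet, eventually_atTop]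

/-- `f` is an integrable probability density on the circle `ℝ / ℤ` with respect to Lebesgue
measure (`volume`, of total mass one). -/
structure IsCircleDensity (f : UnitAddCircle → ℝ) : Prop where
  integrable : Integrable f volume
  nonneg : 0 ≤ᵐ[volume] f
  integral_eq_one : ∫ x, f x = 1

/-- The sequence `X` is i.i.d. under `P`, each `X k` having density `f`. -/
structure IsIIDWithDensity {Ω : Type*} [MeasurableSpace Ω] (P : Measure Ω)
    (X : ℕ+ → Ω → UnitAddCircle) (f : UnitAddCircle → ℝ) : Prop where
  hasLaw : ∀ k, HasLaw (X k) (volume.withDensity fun x => ENNReal.ofReal (f x)) P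
  indep : iIndepFun X P

/-- There is uniform random covering of `A`: `Pr (A ⊆ 𝒰) = 1`. -/
def IsUniformRandomCovering {Ω : Type*} [MeasurableSpace Ω] (P : Measure Ω)
    (ℓ : ℕ+ → ℝ) (X : ℕ+ → Ω → UnitAddCircle) (A : Set UnitAddCircle) : Prop :=
  P {ω | A ⊆ uniformCoveringSet ℓ (fun k => X k ω)} = 1

/-! Fix `d < 1` with `n ℓ n ≤ d log n` for infinitely many `n`. As `f` has mean one, `{f ≤ 1}` has
positive measure, and by Lebesgue differentiation an arc of length `ℓ n` about almost every point
`y` of it has mass at most `(1 + o(1)) ℓ n`. Hence `y` is missed by the first `n` arcs with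
probability at least `n ^ (-β)`, `β < 1`, which dominates `ℓ n` (`tendsto_one_sub_pow_div_atTop`).
Events at points more than `ℓ n` apart are negatively correlated, so a second moment bound
(`pi_measure_farSet_eq_zero_le`) shows that any given piece of `{f ≤ 1}` of positive measure is
fully covered with probability tending to zero along these `n`. This gives uncovered points that
depend on `n`. Baire category on the support of Lebesgue measure restricted to `{f ≤ 1}`
(`exists_mem_frequently_far`) yields one point missed for infinitely many `n`. -/

/-! ### Second moment method for the uncovered set -/

/-- The points at distance more than `r` from every `x i`. -/
def farSet {α ι : Type*} [PseudoMetricSpace α] (r : ℝ) (x : ι → α) : Set α :=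
  {y | ∀ i, r < dist (x i) y}

theorem ENNReal.two_mul_mul_le_sq_add_sq (a b : ℝ≥0∞) : 2 * (a * b) ≤ a ^ 2 + b ^ 2 := by
  induction a with
  | top => simp
  | coe a =>
    induction b with
    | top => simp
    | coe b =>
      norm_cast
      rw [← mul_assoc]
      exact two_mul_le_add_sq a b

/-- Chebyshev's inequality for the event that a nonnegative variable vanishes. -/
theorem measure_eq_zero_le_div {Ω : Type*} [MeasurableSpace Ω] (ν : Measure Ω)
    [IsProbabilityMeasure ν] {Z : Ω → ℝ≥0∞} (hZ : Measurable Z) {m C : ℝ≥0∞}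
    (hm : ∫⁻ ω, Z ω ∂ν = m) (hm0 : m ≠ 0) (hmt : m ≠ ∞)
    (h2 : ∫⁻ ω, Z ω ^ 2 ∂ν ≤ m ^ 2 + C * m) :
    ν {ω | Z ω = 0} ≤ C / m := by
  have hS : MeasurableSet {ω | Z ω = 0} := hZ (measurableSet_singleton 0)
  -- This is `m² 1_{Z = 0} ≤ (Z - m)²`, expanded to avoid subtraction in `ℝ≥0∞`.
  have hpt : ∀ ω, 2 * (m * Z ω) + {ω | Z ω = 0}.indicator (fun _ => m ^ 2) ω
      ≤ Z ω ^ 2 + m ^ 2 := by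
    intro ω
    by_cases h : Z ω = 0
    · simp [Set.indicator, h]
    · simpa [Set.indicator, h, add_comm] using ENNReal.two_mul_mul_le_sq_add_sq m (Z ω)
  have hint := lintegral_mono (μ := ν) hpt
  rw [lintegral_add_left (by fun_prop), lintegral_indicator_const hS,
    lintegral_const_mul _ (by fun_prop), lintegral_const_mul _ hZ, hm,
    lintegral_add_right _ measurable_const, lintegral_const, measure_univ, mul_one] at hint
  have h3 : 2 * (m * m) + m * (m * ν {ω | Z ω = 0}) ≤ 2 * (m * m) + m * C :=
    calc 2 * (m * m) + m * (m * ν {ω | Z ω = 0}) = 2 * (m * m) + m ^ 2 * ν {ω | Z ω = 0} := by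
          ring
      _ ≤ _ := hint
      _ ≤ m ^ 2 + C * m + m ^ 2 := by gcongr
      _ = _ := by ring
  have h4 := (ENNReal.add_le_add_iff_left (by finiteness)).1 h3
  rw [ENNReal.mul_le_mul_iff_right hm0 hmt] at h4
  rw [ENNReal.le_div_iff_mul_le (Or.inl hm0) (Or.inl hmt), mul_comm]
  exact h4

section SecondMoment

variable {α ι : Type*} [PseudoMetricSpace α] [SecondCountableTopology α] [MeasurableSpace α]
  [BorelSpace α] [Fintype ι]

theorem measurableSet_farSet (r : ℝ) :
    MeasurableSet {p : (ι → α) × α | p.2 ∈ farSet r p.1} := by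
  have : {p : (ι → α) × α | p.2 ∈ farSet r p.1} = ⋂ i, {p | r < dist (p.1 i) p.2} := by
    ext p; simp [farSet]
  rw [this]
  refine MeasurableSet.iInter fun i => measurableSet_lt measurable_const ?_
  fun_prop

theorem measurable_measure_farSet (lam : Measure α) [SFinite lam] (r : ℝ) :
    Measurable fun x : ι → α => lam (farSet r x) :=
  measurable_measure_prodMk_left (measurableSet_farSet r)

omit [SecondCountableTopology α] [BorelSpace α] in
theorem pi_mem_farSet (μ : Measure α) [SigmaFinite μ] (r : ℝ) (y : α) :
    Measure.pi (fun _ : ι => μ) {x | y ∈ farSet r x}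
      = μ (Metric.closedBall y r)ᶜ ^ Fintype.card ι := by
  have : {x : ι → α | y ∈ farSet r x} = Set.univ.pi fun _ => (Metric.closedBall y r)ᶜ := by
    ext x; simp [farSet]
  rw [this, Measure.pi_pi]
  simp

omit [SecondCountableTopology α] [BorelSpace α] in
theorem pi_mem_farSet_and (μ : Measure α) [SigmaFinite μ] (r : ℝ) (y z : α) :
    Measure.pi (fun _ : ι => μ) {x | y ∈ farSet r x ∧ z ∈ farSet r x}
      = μ ((Metric.closedBall y r)ᶜ ∩ (Metric.closedBall z r)ᶜ) ^ Fintype.card ι := by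
  have : {x : ι → α | y ∈ farSet r x ∧ z ∈ farSet r x}
      = Set.univ.pi fun _ => (Metric.closedBall y r)ᶜ ∩ (Metric.closedBall z r)ᶜ := by
    ext x; simp [farSet, forall_and]
  rw [this, Measure.pi_pi]
  simp

/-- Negative correlation: `1 - a - b ≤ (1 - a) (1 - b)`. -/
theorem measure_compl_inter_compl_le_mul {β : Type*} [MeasurableSpace β] (μ : Measure β)
    [IsProbabilityMeasure μ] {s t : Set β} (hs : MeasurableSet s) (ht : MeasurableSet t)
    (h : Disjoint s t) : μ (sᶜ ∩ tᶜ) ≤ μ sᶜ * μ tᶜ := by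
  rw [← Set.compl_union, ← ENNReal.toReal_le_toReal (by finiteness) (by finiteness),
    ENNReal.toReal_mul]
  change μ.real _ ≤ μ.real _ * μ.real _
  rw [probReal_compl_eq_one_sub (hs.union ht), probReal_compl_eq_one_sub hs,
    probReal_compl_eq_one_sub ht, measureReal_union h ht]
  nlinarith [measureReal_nonneg (μ := μ) (s := s), measureReal_nonneg (μ := μ) (s := t)]

theorem measurable_measure_compl_closedBall (μ : Measure α) [SFinite μ] (r : ℝ) :
    Measurable fun y => μ (Metric.closedBall y r)ᶜ := by
  have : MeasurableSet {p : α × α | r < dist p.2 p.1} :=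
    measurableSet_lt measurable_const (by fun_prop)
  convert measurable_measure_prodMk_left (ν := μ) this using 3 with y
  ext x; simp

/-- Second moment estimate: the set of points far from `card ι` independent points with law `μ`
is null for `lam` with small probability. -/
theorem pi_measure_farSet_eq_zero_le (μ lam : Measure α) [IsProbabilityMeasure μ]
    [IsFiniteMeasure lam] (r : ℝ) {C : ℝ≥0∞}
    (hC : ∀ z, lam (Metric.closedBall z (2 * r)) ≤ C)
    (hm0 : ∫⁻ y, μ (Metric.closedBall y r)ᶜ ^ Fintype.card ι ∂lam ≠ 0) :
    Measure.pi (fun _ : ι => μ) {x | lam (farSet r x) = 0}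
      ≤ C / ∫⁻ y, μ (Metric.closedBall y r)ᶜ ^ Fintype.card ι ∂lam := by
  set n := Fintype.card ι
  set ν := Measure.pi (fun _ : ι => μ)
  set q : α → ℝ≥0∞ := fun y => μ (Metric.closedBall y r)ᶜ
  have hqm : Measurable q := measurable_measure_compl_closedBall μ r
  have hS := measurableSet_farSet (α := α) (ι := ι) r
  have hfirst : ∫⁻ x, lam (farSet r x) ∂ν = ∫⁻ y, q y ^ n ∂lam := by
    have h1 := Measure.prod_apply (μ := ν) (ν := lam) hS
    rw [Measure.prod_apply_symm hS] at h1
    refine Eq.trans h1.symm (lintegral_congr fun y => ?_)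
    exact pi_mem_farSet μ r y
  refine measure_eq_zero_le_div ν (measurable_measure_farSet lam r) hfirst hm0 ?_ ?_
  · refine ((lintegral_mono fun y => pow_le_one₀ zero_le prob_le_one).trans_lt
      (?_ : ∫⁻ _, 1 ∂lam < ∞)).ne
    simp
  set S2 : Set ((ι → α) × (α × α)) := {p | p.2.1 ∈ farSet r p.1 ∧ p.2.2 ∈ farSet r p.1}
  have hS2 : MeasurableSet S2 := by
    refine MeasurableSet.inter ?_ ?_
    · exact (show Measurable fun p : (ι → α) × (α × α) => (p.1, p.2.1) by fun_prop) hS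
    · exact (show Measurable fun p : (ι → α) × (α × α) => (p.1, p.2.2) by fun_prop) hS
  have h1 := Measure.prod_apply (μ := ν) (ν := lam.prod lam) hS2
  rw [Measure.prod_apply_symm hS2] at h1
  have hL : ∀ x, lam (farSet r x) ^ 2 = (lam.prod lam) (Prod.mk x ⁻¹' S2) := by
    intro x
    rw [sq, ← Measure.prod_prod]
    rfl
  -- Distant pairs have disjoint balls and are negatively correlated; for close pairs one of the two
  -- events is dropped.
  have hR : ∀ p : α × α, ν ((fun x => (x, p)) ⁻¹' S2) ≤
      q p.1 ^ n * q p.2 ^ n + {p : α × α | dist p.2 p.1 ≤ 2 * r}.indicator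
        (fun p => q p.1 ^ n) p := by
    intro p
    refine (pi_mem_farSet_and μ r p.1 p.2).le.trans ?_
    by_cases h : dist p.2 p.1 ≤ 2 * r
    · simp only [Set.indicator, Set.mem_ofPred_eq, h, if_true]
      refine le_add_left ?_
      exact pow_le_pow_left₀ zero_le (measure_mono Set.inter_subset_left) n
    · simp only [Set.indicator, Set.mem_ofPred_eq, h, if_false, add_zero, ← mul_pow]
      gcongr
      refine measure_compl_inter_compl_le_mul μ Metric.isClosed_closedBall.measurableSet
        Metric.isClosed_closedBall.measurableSet ?_
      refine Metric.closedBall_disjoint_closedBall ?_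
      rw [dist_comm]; linarith
  have hD : MeasurableSet {p : α × α | dist p.2 p.1 ≤ 2 * r} :=
    measurableSet_le (by fun_prop) measurable_const
  have hqn : Measurable fun y => q y ^ n := by fun_prop
  calc ∫⁻ x, lam (farSet r x) ^ 2 ∂ν
      = ∫⁻ p, ν ((fun x => (x, p)) ⁻¹' S2) ∂(lam.prod lam) := by
        rw [h1]; exact lintegral_congr hL
    _ ≤ _ := lintegral_mono hR
    _ = (∫⁻ y, q y ^ n ∂lam) ^ 2 + ∫⁻ y, q y ^ n * lam (Metric.closedBall y (2 * r)) ∂lam := by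
        rw [lintegral_add_left (by fun_prop), lintegral_prod_mul hqn.aemeasurable
          hqn.aemeasurable, sq, lintegral_prod _
            (Measurable.indicator (by fun_prop) hD).aemeasurable]
        congr 1
        refine lintegral_congr fun y => ?_
        have : ∀ z, {p : α × α | dist p.2 p.1 ≤ 2 * r}.indicator (fun p => q p.1 ^ n) (y, z)
            = (Metric.closedBall y (2 * r)).indicator (fun _ => q y ^ n) z := fun z => rfl
        simp_rw [this]
        rw [lintegral_indicator_const Metric.isClosed_closedBall.measurableSet]
    _ ≤ (∫⁻ y, q y ^ n ∂lam) ^ 2 + ∫⁻ y, C * q y ^ n ∂lam := by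
        refine add_le_add_right (lintegral_mono fun y => ?_) _
        rw [mul_comm]
        exact mul_le_mul_left (hC y) _
    _ = _ := by rw [lintegral_const_mul _ hqn]

end SecondMoment

/-! ### Size of the probability of missing a point -/

section Asymptotics

variable {ℓ : ℕ+ → ℝ} {l : Filter ℕ+} {d : ℝ}

theorem tendsto_pnat_cast_atTop : Tendsto (fun n : ℕ+ => ((n : ℕ) : ℝ)) atTop atTop :=
  tendsto_natCast_atTop_atTop.comp tendsto_PNat_val_atTop_atTop

theorem tendsto_zero_of_mul_le_log (hl : l ≤ atTop) (hpos : ∀ n, 0 < ℓ n)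
    (hd : ∀ᶠ n : ℕ+ in l, (n : ℕ) * ℓ n ≤ d * Real.log (n : ℕ)) : Tendsto ℓ l (nhds 0) := by
  have h1 : Tendsto (fun n : ℕ+ => d * (Real.log (n : ℕ) / (n : ℕ))) l (nhds 0) := by
    have h := (Real.isLittleO_log_id_atTop.tendsto_div_nhds_zero.comp
      (tendsto_pnat_cast_atTop.mono_left hl)).const_mul d
    simpa using h
  refine squeeze_zero' (Eventually.of_forall fun n => (hpos n).le) ?_ h1
  filter_upwards [hd] with n hn
  have hn0 : (0 : ℝ) < (n : ℕ) := by exact_mod_cast n.pos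
  rw [← mul_div_assoc, le_div_iff₀ hn0]
  linarith

/-- If `p n ≲ ℓ n` and `n ℓ n ≤ d log n` with `d < 1`, then `(1 - p n) ^ n` dominates `ℓ n`. -/
theorem tendsto_one_sub_pow_div_atTop (hl : l ≤ atTop) (hpos : ∀ n, 0 < ℓ n) (hd0 : 0 < d)
    (hd1 : d < 1) (hd : ∀ᶠ n : ℕ+ in l, (n : ℕ) * ℓ n ≤ d * Real.log (n : ℕ)) {p : ℕ+ → ℝ}
    (hp0 : ∀ n, 0 ≤ p n) {a : ℝ} (ha : a ≤ 1) (hp : Tendsto (fun n => p n / ℓ n) l (nhds a)) :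
    Tendsto (fun n => (1 - p n) ^ (n : ℕ) / ℓ n) l atTop := by
  -- One factor `c` is lost in `p n ≤ c ℓ n`, another in `log (1 - p n) ≥ -c p n`; the choice keeps
  -- `c² d < 1`.
  set c : ℝ := 1 + (1 - d) / 3 with hc
  have hc1 : 1 < c := by linarith
  set β : ℝ := c ^ 2 * d with hβ
  have hβ1 : β < 1 := by
    have he : 0 < 1 - d := by linarith
    have : 1 - β = (1 - d) / 3 + 5 * (1 - d) ^ 2 / 9 + (1 - d) ^ 3 / 9 := by
      rw [hβ, hc]; ring
    have : 0 < 1 - β := by rw [this]; positivity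
    linarith
  -- Then `n ^ (1 - β) = n ^ (2 s)`, and `log n ≤ n ^ s / s` uses up only one factor `n ^ s`.
  set s : ℝ := (1 - β) / 2 with hs
  have hs0 : 0 < s := by linarith
  have hlim : Tendsto (fun n : ℕ+ => s / d * ((n : ℕ) : ℝ) ^ s) l atTop :=
    ((tendsto_rpow_atTop hs0).comp (tendsto_pnat_cast_atTop.mono_left hl)).const_mul_atTop
      (by positivity)
  refine tendsto_atTop_mono' l ?_ hlim
  have hsmall : ∀ᶠ n in l, c * ℓ n < 1 - c⁻¹ := by
    have h := (tendsto_zero_of_mul_le_log hl hpos hd).const_mul c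
    rw [mul_zero] at h
    exact h.eventually_lt_const (by linarith [inv_lt_one_of_one_lt₀ hc1])
  filter_upwards [hd, hsmall, hp.eventually_lt_const (lt_of_le_of_lt ha hc1)] with n h1 h2 h3
  have hn0 : (0 : ℝ) < (n : ℕ) := by exact_mod_cast n.pos
  have hp1 : p n ≤ c * ℓ n := ((div_lt_iff₀ (hpos n)).1 h3).le
  have hcp : c⁻¹ < 1 - p n := by linarith
  have hc0 : 0 < c := by linarith
  have hq0 : 0 < 1 - p n := lt_trans (by positivity) hcp
  have hlog : -(c * p n) ≤ Real.log (1 - p n) := by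
    have h4 := Real.one_sub_inv_le_log_of_pos hq0
    have h5 : (1 - p n)⁻¹ ≤ c := by
      rw [inv_le_comm₀ hq0 hc0]; exact hcp.le
    have h6 : 1 - (1 - p n)⁻¹ = -((1 - p n)⁻¹ * p n) := by field_simp; ring
    have h7 := mul_le_mul_of_nonneg_right h5 (hp0 n)
    linarith
  have hpow : ((n : ℕ) : ℝ) ^ (-β) ≤ (1 - p n) ^ (n : ℕ) := by
    rw [← Real.log_le_log_iff (by positivity) (by positivity), Real.log_rpow hn0, Real.log_pow]
    have h8 : c * p n ≤ c * (c * ℓ n) := mul_le_mul_of_nonneg_left hp1 hc0.le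
    calc -β * Real.log (n : ℕ) = -(c ^ 2 * (d * Real.log (n : ℕ))) := by rw [hβ]; ring
      _ ≤ -(c ^ 2 * ((n : ℕ) * ℓ n)) := by
        have := mul_le_mul_of_nonneg_left h1 (sq_nonneg c)
        linarith
      _ = (n : ℕ) * -(c * (c * ℓ n)) := by ring
      _ ≤ (n : ℕ) * Real.log (1 - p n) :=
        mul_le_mul_of_nonneg_left (by linarith) hn0.le
  rw [le_div_iff₀ (hpos n)]
  refine le_trans ?_ hpow
  have hls := Real.log_le_rpow_div hn0.le hs0
  have hmain : s / d * ((n : ℕ) : ℝ) ^ s * (n * ℓ n) ≤ ((n : ℕ) : ℝ) ^ s * ((n : ℕ) : ℝ) ^ s := by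
    calc s / d * ((n : ℕ) : ℝ) ^ s * (n * ℓ n)
        ≤ s / d * ((n : ℕ) : ℝ) ^ s * (d * (((n : ℕ) : ℝ) ^ s / s)) := by
          refine mul_le_mul_of_nonneg_left (h1.trans ?_) (by positivity)
          exact mul_le_mul_of_nonneg_left hls hd0.le
      _ = _ := by field_simp
  have hsum : ((n : ℕ) : ℝ) ^ s * ((n : ℕ) : ℝ) ^ s = ((n : ℕ) : ℝ) ^ (-β) * (n : ℕ) := by
    rw [← Real.rpow_add hn0, ← Real.rpow_add_one hn0.ne']
    congr 1; rw [hs]; ring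
  refine le_of_mul_le_mul_right ?_ hn0
  rw [← hsum]
  linarith

end Asymptotics

theorem volume_real_closedBall_unitAddCircle (y : UnitAddCircle) {r : ℝ} (hr0 : 0 ≤ r)
    (hr : 2 * r ≤ 1) : volume.real (Metric.closedBall y r) = 2 * r := by
  rw [measureReal_def, AddCircle.volume_closedBall, min_eq_right hr, ENNReal.toReal_ofReal]
  linarith

/-! ### Vanishing probability of covering a piece of `{f ≤ 1}` -/

section Circle

variable {ℓ : ℕ+ → ℝ} {l : Filter ℕ+} {d : ℝ} {f : UnitAddCircle → ℝ}

theorem IsCircleDensity.withDensity_real (hf : IsCircleDensity f) (s : Set UnitAddCircle)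
    (hs : MeasurableSet s) :
    (volume.withDensity fun x => ENNReal.ofReal (f x)).real s = ∫ x in s, f x := by
  rw [measureReal_def, withDensity_apply _ hs, ← ofReal_integral_eq_lintegral_ofReal
    hf.integrable.integrableOn (ae_restrict_of_ae hf.nonneg), ENNReal.toReal_ofReal]
  exact integral_nonneg_of_ae (ae_restrict_of_ae hf.nonneg)

theorem IsCircleDensity.ae_tendsto_measure_div (hf : IsCircleDensity f)
    (hℓ : ∀ n, ℓ n ∈ Set.Ioo (0 : ℝ) 1) (hl : Tendsto ℓ l (nhds 0)) :
    ∀ᵐ y, Tendsto (fun n => (volume.withDensity fun x => ENNReal.ofReal (f x)).real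
      (Metric.closedBall y (ℓ n / 2)) / ℓ n) l (nhds (f y)) := by
  filter_upwards [IsUnifLocDoublingMeasure.ae_tendsto_average volume
    hf.integrable.locallyIntegrable 1] with y hy
  have h0 : Tendsto (fun n => ℓ n / 2) l (nhdsWithin 0 (Set.Ioi 0)) := by
    refine tendsto_nhdsWithin_iff.2 ⟨by simpa using hl.div_const 2, ?_⟩
    exact Eventually.of_forall fun n => half_pos (hℓ n).1
  refine (hy (fun _ => y) _ h0 (Eventually.of_forall fun n => ?_)).congr fun n => ?_
  · simpa using (half_pos (hℓ n).1).le
  · rw [hf.withDensity_real _ Metric.isClosed_closedBall.measurableSet, setAverage_eq,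
      volume_real_closedBall_unitAddCircle y (half_pos (hℓ n).1).le (by linarith [(hℓ n).2]),
      smul_eq_mul, mul_div_cancel₀ _ two_ne_zero, inv_mul_eq_div]

/-- Where the density is at most one, a set of positive measure is covered with vanishing
probability along any filter on which `n ℓ n ≤ d log n`, `d < 1`. -/
theorem IsCircleDensity.tendsto_pi_measure_farSet_eq_zero (hf : IsCircleDensity f)
    [IsProbabilityMeasure (volume.withDensity fun x => ENNReal.ofReal (f x))]
    (hℓ : ∀ n, ℓ n ∈ Set.Ioo (0 : ℝ) 1) [l.IsCountablyGenerated] (hl : l ≤ atTop) (hd0 : 0 < d)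
    (hd1 : d < 1) (hd : ∀ᶠ n : ℕ+ in l, (n : ℕ) * ℓ n ≤ d * Real.log (n : ℕ))
    {lam : Measure UnitAddCircle} (hlam : lam ≤ volume) (hlam0 : lam ≠ 0)
    (hf1 : ∀ᵐ y ∂lam, f y ≤ 1) :
    Tendsto (fun n => Measure.pi
        (fun _ : Finset.Icc 1 n => volume.withDensity fun x => ENNReal.ofReal (f x))
        {x | lam (farSet (ℓ n / 2) x) = 0}) l (nhds 0) := by
  set μ := volume.withDensity fun x => ENNReal.ofReal (f x)
  have : IsFiniteMeasure lam := isFiniteMeasure_of_le volume hlam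
  have hpos : ∀ n, 0 < ℓ n := fun n => (hℓ n).1
  have hae : ∀ᵐ y ∂lam, Tendsto (fun n => μ (Metric.closedBall y (ℓ n / 2))ᶜ ^ (n : ℕ)
      / ENNReal.ofReal (ℓ n)) l (nhds ∞) := by
    filter_upwards [hf1, (Measure.absolutelyContinuous_of_le hlam).ae_le
      (hf.ae_tendsto_measure_div hℓ (tendsto_zero_of_mul_le_log hl hpos hd))] with y hy1 hy
    refine (ENNReal.tendsto_ofReal_atTop.comp (tendsto_one_sub_pow_div_atTop hl hpos hd0 hd1 hd
      (fun n => measureReal_nonneg) hy1 hy)).congr fun n => ?_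
    rw [Function.comp_apply, ENNReal.ofReal_div_of_pos (hpos n), ENNReal.ofReal_pow
      (by linarith [measureReal_le_one (μ := μ) (s := Metric.closedBall y (ℓ n / 2))]),
      ← probReal_compl_eq_one_sub Metric.isClosed_closedBall.measurableSet, ofReal_measureReal]
  set m : ℕ+ → ℝ≥0∞ := fun n => ∫⁻ y, μ (Metric.closedBall y (ℓ n / 2))ᶜ ^ (n : ℕ) ∂lam with hm
  have hmeas : ∀ n : ℕ+, Measurable fun y => μ (Metric.closedBall y (ℓ n / 2))ᶜ ^ (n : ℕ) :=
    fun n => (measurable_measure_compl_closedBall μ _).pow_const _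
  have hmlim : Tendsto (fun n => m n / ENNReal.ofReal (ℓ n)) l (nhds ∞) := by
    rcases l.eq_or_neBot with rfl | hne
    · exact tendsto_bot
    -- Fatou turns pointwise divergence into divergence of the first moment.
    have hfatou := lintegral_liminf_le (μ := lam) (u := l)
      (f := fun (n : ℕ+) y => μ (Metric.closedBall y (ℓ n / 2))ᶜ ^ (n : ℕ)
        / ENNReal.ofReal (ℓ n)) fun n => (hmeas n).div_const _
    rw [lintegral_congr_ae (hae.mono fun y hy => hy.liminf_eq), lintegral_const,
      ENNReal.top_mul (by simpa using hlam0), top_le_iff] at hfatou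
    refine tendsto_of_le_liminf_of_limsup_le (hfatou.symm.le.trans (le_of_eq ?_)) le_top
    congr 1
    ext n
    simp_rw [hm, div_eq_mul_inv (b := ENNReal.ofReal (ℓ n))]
    rw [lintegral_mul_const _ (hmeas n)]
  have hlim : Tendsto (fun n => 2 / (m n / ENNReal.ofReal (ℓ n))) l (nhds 0) := by
    simpa using ENNReal.Tendsto.const_div hmlim (Or.inr ENNReal.ofNat_ne_top)
  refine tendsto_of_tendsto_of_tendsto_of_le_of_le' tendsto_const_nhds hlim
    (Eventually.of_forall fun _ => zero_le) ?_
  filter_upwards [hmlim.eventually_ne (b₂ := 0) ENNReal.top_ne_zero] with n hn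
  have hℓ0 : ENNReal.ofReal (ℓ n) ≠ 0 := by simpa using hpos n
  have hm0 : m n ≠ 0 := fun h => hn (by simp [h])
  have hcard : Fintype.card (Finset.Icc 1 n) = n := by simp
  have hC : ∀ z, lam (Metric.closedBall z (2 * (ℓ n / 2))) ≤ 2 * ENNReal.ofReal (ℓ n) := by
    intro z
    refine (hlam _).trans ?_
    rw [AddCircle.volume_closedBall, ← ENNReal.ofReal_ofNat, ← ENNReal.ofReal_mul two_pos.le]
    exact ENNReal.ofReal_le_ofReal ((min_le_right _ _).trans (by linarith))
  have key := pi_measure_farSet_eq_zero_le (ι := Finset.Icc 1 n) μ lam (ℓ n / 2) hC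
    (by rw [hcard]; exact hm0)
  rw [hcard] at key
  refine key.trans (le_of_eq ?_)
  change _ / m n = _
  rw [div_eq_mul_inv, div_eq_mul_inv, div_eq_mul_inv, ENNReal.mul_inv
    (Or.inr (ENNReal.inv_ne_top.2 hℓ0)) (Or.inr (ENNReal.inv_ne_zero.2 ENNReal.ofReal_ne_top)), inv_inv, mul_assoc, mul_comm (ENNReal.ofReal _)]

end Circle

/-! ### Almost sure statements and Baire category -/

theorem IsIIDWithDensity.map_eq_pi {Ω : Type*} [MeasurableSpace Ω] {P : Measure Ω}
    [IsProbabilityMeasure P] {X : ℕ+ → Ω → UnitAddCircle} {f : UnitAddCircle → ℝ}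
    (hX : IsIIDWithDensity P X f) (s : Finset ℕ+) :
    P.map (fun ω (k : s) => X k ω)
      = Measure.pi fun _ => volume.withDensity fun x => ENNReal.ofReal (f x) := by
  have h := iIndepFun.map_fun_eq_pi_map (f := fun (k : s) => X k)
    (fun k => (hX.hasLaw k).aemeasurable) (hX.indep.precomp Subtype.val_injective)
  rw [h]
  congr with k
  rw [(hX.hasLaw k).map_eq]

/-- Failure at all `n ≥ N` is at most as likely as failure at a single such `n`, which tends to
zero; no independence between different `n` is needed. -/
theorem IsCircleDensity.ae_exists_ge_measure_farSet_ne_zero {Ω : Type*} [MeasurableSpace Ω]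
    {P : Measure Ω} [IsProbabilityMeasure P] {X : ℕ+ → Ω → UnitAddCircle}
    {f : UnitAddCircle → ℝ} (hf : IsCircleDensity f) (hX : IsIIDWithDensity P X f)
    {ℓ : ℕ+ → ℝ} (hℓ : ∀ n, ℓ n ∈ Set.Ioo (0 : ℝ) 1) {l : Filter ℕ+} [l.IsCountablyGenerated]
    [l.NeBot] (hl : l ≤ atTop) {d : ℝ} (hd0 : 0 < d) (hd1 : d < 1)
    (hd : ∀ᶠ n : ℕ+ in l, (n : ℕ) * ℓ n ≤ d * Real.log (n : ℕ))
    {lam : Measure UnitAddCircle} (hlam : lam ≤ volume) (hlam0 : lam ≠ 0)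
    (hf1 : ∀ᵐ y ∂lam, f y ≤ 1) (N : ℕ+) :
    ∀ᵐ ω ∂P, ∃ n ≥ N, lam (farSet (ℓ n / 2) fun k : Finset.Icc 1 n => X k ω) ≠ 0 := by
  have : IsFiniteMeasure lam := isFiniteMeasure_of_le volume hlam
  have hμ : IsProbabilityMeasure (volume.withDensity fun x => ENNReal.ofReal (f x)) := by
    rw [← (hX.hasLaw 1).map_eq]
    exact Measure.isProbabilityMeasure_map (hX.hasLaw 1).aemeasurable
  refine le_antisymm ?_ zero_le
  refine ge_of_tendsto (hf.tendsto_pi_measure_farSet_eq_zero hℓ hl hd0 hd1 hd hlam hlam0 hf1) ?_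
  filter_upwards [hl (eventually_ge_atTop N)] with n hn
  have hm : AEMeasurable (fun ω (k : Finset.Icc 1 n) => X k ω) P :=
    aemeasurable_pi_lambda _ fun k => (hX.hasLaw k).aemeasurable
  rw [← hX.map_eq_pi, Measure.map_apply_of_aemeasurable hm
    (show MeasurableSet {x : Finset.Icc 1 n → UnitAddCircle | lam (farSet (ℓ n / 2) x) = 0} from
      measurable_measure_farSet lam _ (measurableSet_singleton 0))]
  refine measure_mono fun ω hω => ?_
  by_contra h
  exact hω ⟨n, hn, h⟩

/-- Baire category: if cofinally many `farSet`s meet every relatively open piece of a nonempty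
compact set `K`, then some point of `K` lies in infinitely many of them. -/
theorem exists_mem_frequently_far {ℓ : ℕ+ → ℝ} {c : ℕ+ → UnitAddCircle} {K : Set UnitAddCircle}
    (hK : IsClosed K) (hne : K.Nonempty) {B : Set (Set UnitAddCircle)}
    (hB : TopologicalSpace.IsTopologicalBasis B)
    (h : ∀ U ∈ B, (U ∩ K).Nonempty → ∀ N : ℕ+, ∃ n ≥ N, ∃ y ∈ U ∩ K, ∀ k ≤ n,
      ℓ n / 2 < dist (c k) y) :
    ∃ y ∈ K, ∀ N : ℕ+, ∃ n ≥ N, ∀ k ≤ n, ℓ n / 2 < dist (c k) y := by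
  have : CompactSpace K := isCompact_iff_compactSpace.1 hK.isCompact
  have : Nonempty K := hne.to_subtype
  set V : ℕ+ → Set K := fun N => ⋃ n ≥ N, ⋂ k ∈ Set.Iic n, {y : K | ℓ n / 2 < dist (c k) y}
  -- The strict inequality, imposed for finitely many `k`, makes each piece open.
  have hV : ∀ N, IsOpen (V N) := fun N => isOpen_biUnion fun n _ =>
    (Set.finite_Iic n).isOpen_biInter fun k _ => isOpen_lt continuous_const (by fun_prop)
  have hD : ∀ N, Dense (V N) := by
    intro N
    refine (hB.isInducing Topology.IsInducing.subtypeVal).dense_iff.2 ?_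
    rintro _ ⟨U, hU, rfl⟩ ⟨z, hz⟩
    obtain ⟨n, hn, y, hy, hfar⟩ := h U hU ⟨z, hz, z.2⟩ N
    refine ⟨⟨y, hy.2⟩, hy.1, ?_⟩
    simp only [V, Set.mem_iUnion, Set.mem_iInter]
    exact ⟨n, hn, hfar⟩
  obtain ⟨y, hy⟩ := (dense_iInter_of_isOpen hV hD).nonempty
  refine ⟨y, y.2, fun N => ?_⟩
  have := Set.mem_iInter.1 hy N
  simp only [V, Set.mem_iUnion, Set.mem_iInter] at this
  obtain ⟨n, hn, hfar⟩ := this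
  exact ⟨n, hn, hfar⟩

theorem IsCircleDensity.restrict_le_one_ne_zero {f : UnitAddCircle → ℝ} (hf : IsCircleDensity f) :
    (volume.restrict {x | f x ≤ 1} : Measure UnitAddCircle) ≠ 0 := by
  intro h
  rw [Measure.restrict_eq_zero] at h
  have hlt : ∀ᵐ x : UnitAddCircle, 1 < f x := by
    filter_upwards [measure_eq_zero_iff_ae_notMem.1 h] with x hx
    exact not_le.1 hx
  have hint : ∫ x, (f x - 1) = 0 := by
    rw [integral_sub hf.integrable (integrable_const _), hf.integral_eq_one,
      integral_const, measureReal_def, UnitAddCircle.measure_univ]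
    simp
  rw [integral_eq_zero_iff_of_nonneg_ae (hlt.mono fun x hx => sub_nonneg.2 hx.le)
    (hf.integrable.sub (integrable_const _))] at hint
  obtain ⟨x, hx1, hx2⟩ := (hlt.and hint).exists
  simp only [Pi.zero_apply] at hx2
  linarith

/-- If `n ℓ n ≤ d log n` for infinitely many `n`, with `d < 1`, the circle is almost surely not
uniformly covered. -/
theorem IsCircleDensity.measure_univ_subset_uniformCoveringSet {Ω : Type*} [MeasurableSpace Ω]
    {P : Measure Ω} [IsProbabilityMeasure P] {X : ℕ+ → Ω → UnitAddCircle}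
    {f : UnitAddCircle → ℝ} (hf : IsCircleDensity f) (hX : IsIIDWithDensity P X f)
    {ℓ : ℕ+ → ℝ} (hℓ : ∀ n, ℓ n ∈ Set.Ioo (0 : ℝ) 1) {d : ℝ} (hd0 : 0 < d) (hd1 : d < 1)
    (hS : ∃ᶠ n : ℕ+ in atTop, (n : ℕ) * ℓ n ≤ d * Real.log (n : ℕ)) :
    P {ω | Set.univ ⊆ uniformCoveringSet ℓ fun k => X k ω} = 0 := by
  have hne : (atTop ⊓ 𝓟 {n : ℕ+ | (n : ℕ) * ℓ n ≤ d * Real.log (n : ℕ)}).NeBot :=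
    frequently_mem_iff_neBot.1 hS
  have hSl : ∀ᶠ n : ℕ+ in atTop ⊓ 𝓟 {n : ℕ+ | (n : ℕ) * ℓ n ≤ d * Real.log (n : ℕ)},
      (n : ℕ) * ℓ n ≤ d * Real.log (n : ℕ) :=
    mem_inf_of_right (mem_principal_self _)
  have hA : NullMeasurableSet {x | f x ≤ 1} volume :=
    nullMeasurableSet_le hf.integrable.aemeasurable aemeasurable_const
  obtain ⟨lam, hlam⟩ : ∃ lam : Measure UnitAddCircle, lam = volume.restrict {x | f x ≤ 1} :=
    ⟨_, rfl⟩
  have hlam_le : lam ≤ volume := by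
    rw [hlam]; exact Measure.restrict_le_self
  have hlam0 : lam ≠ 0 := by
    rw [hlam]; exact hf.restrict_le_one_ne_zero
  have hf1 : ∀ᵐ y ∂lam, f y ≤ 1 := by
    rw [hlam]; exact ae_restrict_mem₀ hA
  set K := lam.support
  have hKne : K.Nonempty := Measure.nonempty_support hlam0
  obtain ⟨B, hBc, -, hB⟩ := TopologicalSpace.exists_countable_basis UnitAddCircle
  have hae : ∀ᵐ ω ∂P, ∀ U ∈ B, (U ∩ K).Nonempty → ∀ N : ℕ+, ∃ n ≥ N, ∃ y ∈ U ∩ K, ∀ k ≤ n,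
      ℓ n / 2 < dist (X k ω) y := by
    refine (ae_ball_iff hBc).2 fun U hU => ?_
    by_cases hUK : (U ∩ K).Nonempty
    swap
    · exact Eventually.of_forall fun ω h => absurd h hUK
    -- This is why `K` is the support: every basic open set meeting it has positive `lam`-mass.
    have hU0 : lam.restrict U ≠ 0 := by
      obtain ⟨z, hzU, hzK⟩ := hUK
      rw [Ne, Measure.restrict_eq_zero]
      exact ((Measure.mem_support_iff_forall z).1 hzK U ((hB.isOpen hU).mem_nhds hzU)).ne'
    have hall := ae_all_iff.2 (hf.ae_exists_ge_measure_farSet_ne_zero hX hℓ inf_le_left hd0 hd1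
      hSl (Measure.restrict_le_self.trans hlam_le) hU0 (ae_restrict_of_ae hf1))
    filter_upwards [hall] with ω hω _ N
    obtain ⟨n, hn, hpos⟩ := hω N
    have hmem : ∀ᵐ y ∂lam.restrict U, y ∈ U ∩ K :=
      (ae_restrict_mem (hB.isOpen hU).measurableSet).and
        (ae_restrict_of_ae (Measure.support_mem_ae (μ := lam)))
    obtain ⟨y, hy, hyUK⟩ := ((frequently_ae_mem_iff.2 hpos).and_eventually hmem).exists
    exact ⟨n, hn, y, hyUK, fun k hk => hy ⟨k, Finset.mem_Icc.2 ⟨one_le, hk⟩⟩⟩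
  refine measure_mono_null (fun ω hω => ?_) (ae_iff.1 hae)
  intro hgood
  obtain ⟨y, -, hy⟩ := exists_mem_frequently_far Measure.isClosed_support hKne hB hgood
  obtain ⟨N, hN⟩ := (mem_uniformCoveringSet ℓ _ y).1 (hω (Set.mem_univ y))
  obtain ⟨n, hn, hfar⟩ := hy N
  obtain ⟨k, hk, hlt⟩ := hN n hn
  have := hfar k hk
  rw [dist_comm] at this
  exact lt_asymm this hlt

theorem mainTheorem3 (ℓ : ℕ+ → ℝ) (hℓ_anti : Antitone ℓ) (hℓ : ∀ n, ℓ n ∈ Set.Ioo (0 : ℝ) 1)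
    (hδ : coveringExponent ℓ < 1) :
    ¬ ∃ (f : UnitAddCircle → ℝ) (Ω : Type*) (_ : MeasurableSpace Ω) (P : Measure Ω)
        (X : ℕ+ → Ω → UnitAddCircle),
      IsCircleDensity f ∧ IsProbabilityMeasure P ∧ IsIIDWithDensity P X f ∧
        IsUniformRandomCovering P ℓ X Set.univ := by
  rintro ⟨f, Ω, _, P, X, hf, _, hX, hcov⟩
  obtain ⟨d', hd'1, hd'2⟩ := EReal.lt_iff_exists_real_btwn.1 hδ
  have hd'1' : d' < 1 := by exact_mod_cast hd'2
  have hfreq := frequently_lt_of_liminf_lt (by isBoundedDefault) hd'1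
  -- The maximum with `1 / 2` makes the constant positive, since `d'` need not be.
  have hS : ∃ᶠ n : ℕ+ in atTop, (n : ℕ) * ℓ n ≤ max d' (1 / 2) * Real.log (n : ℕ) := by
    refine (hfreq.and_eventually (eventually_gt_atTop 1)).mono fun n ⟨hn, hn1⟩ => ?_
    have hlog : 0 < Real.log (n : ℕ) := Real.log_pos (by exact_mod_cast hn1)
    have hn' : (n : ℕ) * ℓ n / Real.log (n : ℕ) < d' := by exact_mod_cast hn
    exact (div_le_iff₀ hlog).1 (hn'.le.trans (le_max_left _ _))
  have hnull := hf.measure_univ_subset_uniformCoveringSet hX hℓ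
    (lt_max_of_lt_right (by norm_num)) (max_lt hd'1' (by norm_num)) hS
  rw [IsUniformRandomCovering, hnull] at hcov
  exact zero_ne_one hcov
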